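/- For $m$ fermionic modes, let $\mathcal F_m$ be the Fock space of dimension $2^m$ with annihilation operators $a_1,\dots,a_m$, identified with $m$ qubits through the occupation-number basis: $a_j|y\rangle=(-1)^{\#\{k<j:\,y_k=1\}}\,|y\text{ with }y_j:=0\rangle$ if $y_j=1$, and $a_j|y\rangle=0$ if $y_j=0$. For a Hermitian matrix $A\in\mathbb C^{m\times m}$ and any matrix $B\in\mathbb C^{m\times m}$, the quadratic Hamiltonian is $$H_{A,B}=\sum_{i,j}A_{ij}\,a_i^\dagger a_j+\tfrac12\sum_{i,j}B_{ij}\,a_ia_j+\tfrac12\sum_{i,j}\overline{B_{ji}}\,a_i^\dagger a_j^\dagger .$$ A circuit is a finite sequence of gates, each an arbitrary unitary on two distinct qubits; its complexity is the number of gates. A family of Hamiltonians $(H_n)_{n\ge1}$, $H_n$ acting on $m(n)$ qubits, can be $(T,\alpha)$-fast-forwarded if there is a polynomial $p$ such that for all $n\ge1$ and all real $t$ with $0\le t\le T(n)$ there are $c\le p(n)$ ancilla qubits and a circuit $\widetilde U$ of at most $p(n)$ gates on the $m(n)+c$ qubits with $$\bigl\|\bigl(e^{-iH_nt}\otimes \mathbb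 1_{2^c}-\widetilde U\bigr)\,|\psi\rangle\otimes|0^c\rangle\bigr\|\le\alpha(n)\qquad\text{for all unit vectors }\psi .$$ **Theorem.** Let $m(n)$ be bounded by a polynomial in $n$, let $A_n,B_n\in\mathbb C^{m(n)\times m(n)}$ with $A_n$ Hermitian, and let $H_n=H_{A_n,B_n}$. Let $T(n)=2^{\Omega(n)}$ be any function (i.e. $T(n)\ge2^{cn}$ for some constant $c>0$ and all large $n$), and let $\alpha$ be any inverse-polynomial accuracy, i.e. there is a polynomial $q$ with natural-number coefficients such that $q(n)>0$ and $\alpha(n)\ge1/q(n)$ for all $n\ge1$. Then $(H_n)_{n\ge 1}$ can be $(T,\alpha)$-fast-forwarded. The bound holds on the whole Fock space, so in particular for all $n$-fermion states when $H_n$ preserves the particle number, and no normalization of $H_n$ is needed. -/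

import Mathlib

noncomputable section

/-! ### Qubit registers and circuits of two-qubit gates -/

/-- Pure (unnormalised) states of a register of qubits labelled by `Q`: the Hilbert space with
orthonormal computational basis `Q → Bool`. -/
abbrev QState (Q : Type) [Fintype Q] : Type := EuclideanSpace ℂ (Q → Bool)

/-- Linear operators on the register `Q`, as matrices in the computational basis. -/
abbrev QOp (Q : Type) : Type := Matrix (Q → Bool) (Q → Bool) ℂ

/-- Application of an operator to a state. -/
def QOp.app {Q : Type} [Fintype Q] [DecidableEq Q] (M : QOp Q) (ψ : QState Q) : QState Q :=
  WithLp.toLp 2 (Matrix.mulVec M ψ.ofLp)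

/-- A two-qubit gate: an arbitrary two-qubit unitary `U`, applied to the ordered pair of distinct
qubits `(fst, snd)`. (A one-qubit gate is the special case in which `U` acts trivially on one of
the two.) -/
structure TwoQubitGate (Q : Type) where
  fst : Q
  snd : Q
  ne : fst ≠ snd
  U : Matrix.unitaryGroup (Bool × Bool) ℂ

/-- The operator of a gate on the whole register: `U` on the two qubits it touches, tensored with
the identity on all the others. -/
def TwoQubitGate.toOp {Q : Type} [Fintype Q] [DecidableEq Q] (g : TwoQubitGate Q) : QOp Q :=
  Matrix.of fun x y =>
    if ∀ k, k ≠ g.fst → k ≠ g.snd → x k = y k then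
      (g.U : Matrix (Bool × Bool) (Bool × Bool) ℂ) (x g.fst, x g.snd) (y g.fst, y g.snd)
    else 0

/-- A quantum circuit is a finite sequence of two-qubit gates; its complexity is its length. -/
abbrev QCircuit (Q : Type) : Type := List (TwoQubitGate Q)

/-- The operator of a circuit; the head of the list is the gate applied first. -/
def QCircuit.toOp {Q : Type} [Fintype Q] [DecidableEq Q] : QCircuit Q → QOp Q
  | [] => 1
  | g :: C => QCircuit.toOp C * g.toOp

/-- The state `ψ ⊗ |0…0⟩` of a system register `Q` together with an ancilla register `R`. -/
def withZeroAncillas {Q : Type} (R : Type) [Fintype Q] [Fintype R] (ψ : QState Q) :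
    QState (Q ⊕ R) :=
  WithLp.toLp 2 fun x =>
    if ∀ r : R, x (Sum.inr r) = false then ψ.ofLp (fun k => x (Sum.inl k)) else 0

/-- The operator `M ⊗ 1` on a system register `Q` together with an ancilla register `R`. -/
def onSystem {Q : Type} (R : Type) [Fintype R] (M : QOp Q) : QOp (Q ⊕ R) :=
  Matrix.of fun x y =>
    if ∀ r : R, x (Sum.inr r) = y (Sum.inr r) then
      M (fun k => x (Sum.inl k)) (fun k => y (Sum.inl k))
    else 0

/-- The time evolution `e^{-iHt}`. -/
def evolution {Q : Type} [Fintype Q] [DecidableEq Q] (H : QOp Q) (t : ℝ) : QOp Q :=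
  NormedSpace.exp ((-(Complex.I * (t : ℂ))) • H)

/-! ### Asymptotic classes -/

/-- `m(n) = poly(n)`. -/
def IsPolyBounded (m : ℕ → ℕ) : Prop :=
  ∃ p : Polynomial ℕ, ∀ n, 1 ≤ n → m n ≤ p.eval n

/-- `α(n)` is at least the inverse of a polynomial that is positive at positive integers. -/
def IsInversePoly (α : ℕ → ℝ) : Prop :=
  ∃ p : Polynomial ℕ, ∀ n, 1 ≤ n → 0 < p.eval n ∧ 1 / ((p.eval n : ℕ) : ℝ) ≤ α n

/-- `T(n) = 2^{Ω(n)}`. -/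
def IsTwoPowOmega (T : ℕ → ℝ) : Prop :=
  ∃ c : ℝ, 0 < c ∧ ∀ᶠ n : ℕ in Filter.atTop, (2 : ℝ) ^ (c * (n : ℝ)) ≤ T n

/-! ### Fast forwarding -/

/-- The family of Hamiltonians `H n` (`n ≥ 1`), where `H n` acts on `m n` qubits, can be
`(T, α)`-fast forwarded: there is a polynomial `p` such that for all `n ≥ 1` and all times
`0 ≤ t ≤ T n` some circuit of at most `p n` two-qubit gates, acting on the system and on at most
`p n` ancilla qubits initialised to `0`, satisfies
`‖(e^{-iHt} ⊗ 1 - C) |ψ⟩ ⊗ |0⟩‖ ≤ α n` for every unit vector `ψ`. The normalisation `‖H n‖ = 1`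
only fixes the unit of time; the notion is stated for Hamiltonians of any norm, which includes the
normalised ones. -/
def CanBeFastForwarded (m : ℕ → ℕ) (H : ∀ n, QOp (Fin (m n))) (T α : ℕ → ℝ) : Prop :=
  ∃ p : Polynomial ℕ, ∀ n, 1 ≤ n → ∀ t : ℝ, 0 ≤ t → t ≤ T n →
    ∃ (c : ℕ) (C : QCircuit (Fin (m n) ⊕ Fin c)),
      c ≤ p.eval n ∧ C.length ≤ p.eval n ∧
      ∀ ψ : QState (Fin (m n)), ‖ψ‖ = 1 →
        ‖QOp.app (onSystem (Fin c) (evolution (H n) t) - C.toOp)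
          (withZeroAncillas (Fin c) ψ)‖ ≤ α n

/-! ### Fermions -/

/-- The annihilation operator `a_j` on the Fock space of `m` fermionic modes, in the occupation
number basis `|y_0, …, y_{m-1}⟩` (mode `k` is occupied iff `y k = true`), which is identified with
the computational basis of `m` qubits:
`a_j |y⟩ = (-1)^{#{k < j : y_k = 1}} |y with y_j := 0⟩` if `y_j = 1`, and `a_j |y⟩ = 0` otherwise. -/
def annihilation {m : ℕ} (j : Fin m) : QOp (Fin m) :=
  Matrix.of fun x y =>
    if y j = true ∧ x = Function.update y j false then
      (-1 : ℂ) ^ (Finset.univ.filter fun k : Fin m => k < j ∧ y k = true).card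
    else 0

/-- The creation operator `a_j†`. -/
def creation {m : ℕ} (j : Fin m) : QOp (Fin m) :=
  (annihilation j).conjTranspose

/-- The quadratic Hamiltonian
`∑ A_{ij} a_i† a_j + ½ ∑ B_{ij} a_i a_j + ½ ∑ B_{ji}^* a_i† a_j†`, which is Hermitian as soon as
`A` is (the last two sums are adjoint to each other for every `B`). -/
def quadraticHamiltonian {m : ℕ} (A B : Matrix (Fin m) (Fin m) ℂ) : QOp (Fin m) :=
  (∑ i, ∑ j, A i j • (creation i * annihilation j))
    + (1 / 2 : ℂ) • (∑ i, ∑ j, B i j • (annihilation i * annihilation j))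
    + (1 / 2 : ℂ) • (∑ i, ∑ j, (starRingEnd ℂ) (B j i) • (creation i * creation j))

end

/-!
The evolution under a quadratic Hamiltonian is a circuit of polynomial size *exactly*, whatever the
time, so the error of the approximation is `0`.

Let `γ 0, …, γ (2m - 1)` be the Majorana operators of the modes, `V` their complex span. An
anticommutator of elements of `V` is a scalar, so the commutator with a product of two elements of
`V` preserves `V` (`IsMajorana.commutator_mem`), and so does the commutator with the Hamiltonian
`H`. Hence `v ↦ e^{-iHt} v e^{iHt}`, the exponential of `ad (-iHt)`, maps `V` to itself
(`isGaussian_evolution`). Being a `*`-automorphism that preserves anticommutators, it acts on the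
`γ k` by a real orthogonal `2m × 2m` matrix.

As in a QR decomposition, that matrix is a product of `O(m²)` Givens rotations of neighbouring
`γ k`, `γ (k + 1)` and reflections of the last `γ`
(`IsMajorana.exists_list_of_isGaussian`); since the Majorana operators act irreducibly
(`eq_smul_one_of_commute_majorana`), the evolution equals the corresponding product of operators up
to a phase. In the Jordan-Wigner representation `γ (2j) γ (2j + 1) = i Z_j` and
`γ (2j + 1) γ (2j + 2) = i X_j X_{j+1}`, so that the Givens rotations `c + s γ k γ (k + 1)` are one-
or two-qubit gates (`isGate_givens`), and the reflection of the last `γ` is the one-qubit gate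
`X_{m-1}`. Two ancillas are spent on making one-qubit gates and the global phase two-qubit gates on
distinct qubits, even when `m ≤ 1`.
-/

/-! ### Clifford generators and their Gaussian unitaries -/

section Clifford

set_option linter.unusedSectionVars false

variable {𝔸 : Type*} [Ring 𝔸] [StarRing 𝔸] [Algebra ℂ 𝔸] [StarModule ℂ 𝔸]

/-- The elements `γ 0, …, γ (N - 1)` are Majorana operators: self-adjoint, with square one, and
pairwise anticommuting. Values of `γ` beyond `N` are irrelevant. -/
structure IsMajorana (γ : ℕ → 𝔸) (N : ℕ) : Prop where
  star_eq : ∀ i < N, star (γ i) = γ i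
  sq : ∀ i < N, γ i * γ i = 1
  anticomm : ∀ i < N, ∀ j < N, i ≠ j → γ i * γ j = -(γ j * γ i)

/-- The complex span of the first `N` Majorana operators. -/
def majoranaSpan (γ : ℕ → 𝔸) (N : ℕ) : Submodule ℂ 𝔸 :=
  Submodule.span ℂ (γ '' (Finset.range N : Set ℕ))

/-- A unitary is Gaussian with respect to a space `V` of operators if conjugation by it and by its
inverse maps `V` to itself. -/
structure IsGaussian (V : Submodule ℂ 𝔸) (U : 𝔸) : Prop where
  mem : U ∈ unitary 𝔸
  conj : ∀ v ∈ V, U * v * star U ∈ V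
  conj_star : ∀ v ∈ V, star U * v * U ∈ V

theorem IsGaussian.one (V : Submodule ℂ 𝔸) : IsGaussian V (1 : 𝔸) :=
  ⟨one_mem _, fun v hv => by simpa using hv, fun v hv => by simpa using hv⟩

theorem IsGaussian.star {V : Submodule ℂ 𝔸} {U : 𝔸} (h : IsGaussian V U) :
    IsGaussian V (star U) :=
  ⟨Unitary.star_mem h.mem, fun v hv => by simpa using h.conj_star v hv,
    fun v hv => by simpa using h.conj v hv⟩

theorem IsGaussian.mul {V : Submodule ℂ 𝔸} {U W : 𝔸} (h : IsGaussian V U)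
    (h' : IsGaussian V W) : IsGaussian V (U * W) :=
  ⟨mul_mem h.mem h'.mem,
    fun v hv => by simpa [mul_assoc] using h.conj _ (h'.conj v hv),
    fun v hv => by simpa [mul_assoc] using h'.conj_star _ (h.conj_star v hv)⟩

theorem mem_majoranaSpan {γ : ℕ → 𝔸} {N i : ℕ} (hi : i < N) : γ i ∈ majoranaSpan γ N :=
  Submodule.subset_span ⟨i, by simpa using hi, rfl⟩

theorem mem_majoranaSpan_iff {γ : ℕ → 𝔸} {N : ℕ} {v : 𝔸} :
    v ∈ majoranaSpan γ N ↔ ∃ z : ℕ → ℂ, v = ∑ i ∈ Finset.range N, z i • γ i := by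
  constructor
  · intro hv
    obtain ⟨z, hz⟩ := (Submodule.mem_span_image_finset_iff_exists_fun' ℂ).1 hv
    exact ⟨z, hz.symm⟩
  · rintro ⟨z, rfl⟩
    exact Submodule.sum_mem _ fun i hi =>
      Submodule.smul_mem _ _ (mem_majoranaSpan (by simpa using hi))

/-- A conjugation that maps the generators into their span maps the whole span into itself. -/
theorem conj_mem_majoranaSpan {γ : ℕ → 𝔸} {N : ℕ} {a b : 𝔸}
    (h : ∀ i < N, a * γ i * b ∈ majoranaSpan γ N) {v : 𝔸} (hv : v ∈ majoranaSpan γ N) :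
    a * v * b ∈ majoranaSpan γ N := by
  obtain ⟨z, rfl⟩ := mem_majoranaSpan_iff.1 hv
  rw [Finset.mul_sum, Finset.sum_mul]
  refine Submodule.sum_mem _ fun i hi => ?_
  rw [mul_smul_comm, smul_mul_assoc]
  exact Submodule.smul_mem _ _ (h i (by simpa using hi))

namespace IsMajorana

variable {γ : ℕ → 𝔸} {N : ℕ}

theorem anticomm_sum (hγ : IsMajorana γ N) (z : ℕ → ℂ) {j : ℕ} (hj : j < N) :
    (∑ i ∈ Finset.range N, z i • γ i) * γ j + γ j * (∑ i ∈ Finset.range N, z i • γ i)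
      = (2 * z j) • 1 := by
  rw [Finset.sum_mul, Finset.mul_sum, ← Finset.sum_add_distrib,
    Finset.sum_eq_single_of_mem j (by simpa using hj)]
  · rw [smul_mul_assoc, mul_smul_comm, hγ.sq j hj, ← add_smul, two_mul]
  · intro i hi hij
    rw [smul_mul_assoc, mul_smul_comm, hγ.anticomm i (by simpa using hi) j hj hij]
    simp

theorem anticomm_sum_sum (hγ : IsMajorana γ N) (z w : ℕ → ℂ) :
    (∑ i ∈ Finset.range N, z i • γ i) * (∑ i ∈ Finset.range N, w i • γ i)
      + (∑ i ∈ Finset.range N, w i • γ i) * (∑ i ∈ Finset.range N, z i • γ i)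
      = (∑ i ∈ Finset.range N, 2 * z i * w i) • 1 := by
  rw [Finset.mul_sum (Finset.range N) (fun i => w i • γ i),
    Finset.sum_mul (Finset.range N) (fun i => w i • γ i), ← Finset.sum_add_distrib,
    Finset.sum_smul]
  refine Finset.sum_congr rfl fun j hj => ?_
  rw [mul_smul_comm, smul_mul_assoc, ← smul_add, hγ.anticomm_sum z (by simpa using hj), smul_smul,
    mul_comm]

/-- The anticommutator of two elements of the span is a scalar. -/
theorem exists_anticomm_eq (hγ : IsMajorana γ N) {v w : 𝔸} (hv : v ∈ majoranaSpan γ N)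
    (hw : w ∈ majoranaSpan γ N) : ∃ c : ℂ, v * w + w * v = c • 1 := by
  obtain ⟨z, rfl⟩ := mem_majoranaSpan_iff.1 hv
  obtain ⟨z', rfl⟩ := mem_majoranaSpan_iff.1 hw
  exact ⟨_, hγ.anticomm_sum_sum z z'⟩

/-- The commutator with a product of two elements of the span preserves the span. -/
theorem commutator_mem (hγ : IsMajorana γ N) {x y v : 𝔸} (hx : x ∈ majoranaSpan γ N)
    (hy : y ∈ majoranaSpan γ N) (hv : v ∈ majoranaSpan γ N) :
    x * y * v - v * (x * y) ∈ majoranaSpan γ N := by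
  obtain ⟨c, hc⟩ := hγ.exists_anticomm_eq hy hv
  obtain ⟨d, hd⟩ := hγ.exists_anticomm_eq hx hv
  have : x * y * v - v * (x * y) = c • x - d • y := by
    calc x * y * v - v * (x * y) = x * (y * v + v * y) - (x * v + v * x) * y := by noncomm_ring
      _ = c • x - d • y := by rw [hc, hd]; simp
  rw [this]
  exact Submodule.sub_mem _ (Submodule.smul_mem _ _ hx) (Submodule.smul_mem _ _ hy)

/-- A self-adjoint element of the span with square one is a real unit combination of the
generators. -/
theorem exists_real_coeff [Nontrivial 𝔸] (hγ : IsMajorana γ N) {v : 𝔸}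
    (hv : v ∈ majoranaSpan γ N) (hs : star v = v) (hsq : v * v = 1) :
    ∃ r : ℕ → ℝ, v = ∑ i ∈ Finset.range N, (r i : ℂ) • γ i ∧
      ∑ i ∈ Finset.range N, r i ^ 2 = 1 := by
  obtain ⟨z, hz⟩ := mem_majoranaSpan_iff.1 hv
  have hreal : v = ∑ i ∈ Finset.range N, ((z i).re : ℂ) • γ i := by
    have h1 : v = (1 / 2 : ℂ) • (v + star v) := by
      rw [hs, ← two_smul ℂ v, smul_smul]; norm_num
    rw [h1, hz, star_sum, ← Finset.sum_add_distrib, Finset.smul_sum]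
    refine Finset.sum_congr rfl fun i hi => ?_
    rw [star_smul, hγ.star_eq i (by simpa using hi), ← add_smul, smul_smul]
    congr 1
    have := Complex.add_conj (z i)
    simp only [starRingEnd_apply] at this
    rw [this]; push_cast; ring
  refine ⟨fun i => (z i).re, hreal, ?_⟩
  have h2 := hγ.anticomm_sum_sum (fun i => ((z i).re : ℂ)) (fun i => ((z i).re : ℂ))
  rw [← hreal, hsq, ← two_smul ℂ (1 : 𝔸)] at h2
  have h3 := smul_left_injective ℂ (one_ne_zero (α := 𝔸)) h2
  have h4 : (2 : ℝ) = ∑ i ∈ Finset.range N, 2 * (z i).re * (z i).re := by exact_mod_cast h3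
  have h5 : ∑ i ∈ Finset.range N, 2 * (z i).re * (z i).re
      = 2 * ∑ i ∈ Finset.range N, (z i).re ^ 2 := by
    rw [Finset.mul_sum]; exact Finset.sum_congr rfl fun i _ => by ring
  linarith

end IsMajorana

/-- The Givens rotation in the plane of `γ k` and `γ (k + 1)`, with `c` and `s` the cosine and sine
of half the rotation angle. -/
def givens (γ : ℕ → 𝔸) (k : ℕ) (c s : ℝ) : 𝔸 := (c : ℂ) • 1 + (s : ℂ) • (γ k * γ (k + 1))

namespace IsMajorana

variable {γ : ℕ → 𝔸} {N : ℕ}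

theorem star_givens (hγ : IsMajorana γ N) {k : ℕ} (hk : k + 1 < N) (c s : ℝ) :
    star (givens γ k c s) = givens γ k c (-s) := by
  simp only [givens, star_add, star_smul, star_mul, star_one, hγ.star_eq k (by omega),
    hγ.star_eq (k + 1) hk, hγ.anticomm (k + 1) hk k (by omega) (by omega)]
  simp

theorem bivector_sq (hγ : IsMajorana γ N) {k : ℕ} (hk : k + 1 < N) :
    γ k * γ (k + 1) * (γ k * γ (k + 1)) = -1 := by
  have h := hγ.anticomm (k + 1) hk k (by omega) (by omega)
  calc γ k * γ (k + 1) * (γ k * γ (k + 1)) = γ k * (γ (k + 1) * γ k) * γ (k + 1) := by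
        noncomm_ring
    _ = -((γ k * γ k) * (γ (k + 1) * γ (k + 1))) := by rw [h]; noncomm_ring
    _ = -1 := by rw [hγ.sq k (by omega), hγ.sq (k + 1) hk, one_mul]

theorem givens_mul_givens (hγ : IsMajorana γ N) {k : ℕ} (hk : k + 1 < N) (c s c' s' : ℝ) :
    givens γ k c s * givens γ k c' s' = givens γ k (c * c' - s * s') (c * s' + s * c') := by
  simp only [givens, add_mul, mul_add, smul_mul_smul_comm, hγ.bivector_sq hk, one_mul, mul_one]
  push_cast
  module

theorem givens_mem_unitary (hγ : IsMajorana γ N) {k : ℕ} (hk : k + 1 < N) {c s : ℝ}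
    (hcs : c ^ 2 + s ^ 2 = 1) : givens γ k c s ∈ unitary 𝔸 := by
  rw [Unitary.mem_iff, hγ.star_givens hk, hγ.givens_mul_givens hk, hγ.givens_mul_givens hk]
  have h1 : c * c - -s * s = 1 := by linarith
  have h2 : c * c - s * -s = 1 := by linarith
  rw [h1, h2]
  constructor <;> simp [givens, mul_comm]

/-- A Givens rotation commutes with the generators outside its plane. -/
theorem givens_conj_of_ne (hγ : IsMajorana γ N) {k j : ℕ} (hk : k + 1 < N) (hj : j < N)
    (h1 : j ≠ k) (h2 : j ≠ k + 1) {c s : ℝ} (hcs : c ^ 2 + s ^ 2 = 1) :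
    givens γ k c s * γ j * star (givens γ k c s) = γ j := by
  have hc : givens γ k c s * γ j = γ j * givens γ k c s := by
    have : γ k * γ (k + 1) * γ j = γ j * (γ k * γ (k + 1)) := by
      rw [mul_assoc, hγ.anticomm (k + 1) hk j hj h2.symm, mul_neg, ← mul_assoc,
        hγ.anticomm k (by omega) j hj h1.symm, neg_mul, neg_neg, mul_assoc]
    simp [givens, add_mul, mul_add, this]
  rw [hc, mul_assoc, (Unitary.mem_iff.1 (hγ.givens_mem_unitary hk hcs)).2, mul_one]

theorem givens_conj_left (hγ : IsMajorana γ N) {k : ℕ} (hk : k + 1 < N) (c s : ℝ) :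
    givens γ k c s * γ k * star (givens γ k c s)
      = ((c ^ 2 - s ^ 2 : ℝ) : ℂ) • γ k + ((-(2 * c * s) : ℝ) : ℂ) • γ (k + 1) := by
  have h := hγ.anticomm (k + 1) hk k (by omega) (by omega)
  have hc : givens γ k c s * γ k = γ k * givens γ k c (-s) := by
    have : γ k * γ (k + 1) * γ k = -(γ k * (γ k * γ (k + 1))) := by
      rw [mul_assoc, h, mul_neg]
    simp [givens, add_mul, mul_add, this]
  rw [hc, hγ.star_givens hk, mul_assoc, hγ.givens_mul_givens hk, givens, mul_add, mul_smul_comm,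
    mul_smul_comm, mul_one, ← mul_assoc, hγ.sq k (by omega), one_mul]
  congr 3 <;> ring

theorem givens_conj_right (hγ : IsMajorana γ N) {k : ℕ} (hk : k + 1 < N) (c s : ℝ) :
    givens γ k c s * γ (k + 1) * star (givens γ k c s)
      = ((c ^ 2 - s ^ 2 : ℝ) : ℂ) • γ (k + 1) + ((2 * c * s : ℝ) : ℂ) • γ k := by
  have h := hγ.anticomm (k + 1) hk k (by omega) (by omega)
  have hc : γ (k + 1) * givens γ k c (-s) = givens γ k c s * γ (k + 1) := by
    have : γ (k + 1) * (γ k * γ (k + 1)) = -(γ k * γ (k + 1) * γ (k + 1)) := by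
      rw [← mul_assoc, h, neg_mul]
    simp [givens, add_mul, mul_add, this]
  rw [mul_assoc, hγ.star_givens hk, hc, ← mul_assoc, hγ.givens_mul_givens hk, givens, add_mul,
    smul_mul_assoc, smul_mul_assoc, one_mul, mul_assoc, hγ.sq (k + 1) hk, mul_one]
  congr 3 <;> ring

theorem isGaussian_givens (hγ : IsMajorana γ N) {k : ℕ} (hk : k + 1 < N) {c s : ℝ}
    (hcs : c ^ 2 + s ^ 2 = 1) : IsGaussian (majoranaSpan γ N) (givens γ k c s) := by
  have key : ∀ s : ℝ, c ^ 2 + s ^ 2 = 1 → ∀ v ∈ majoranaSpan γ N,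
      givens γ k c s * v * star (givens γ k c s) ∈ majoranaSpan γ N := by
    intro s hcs v hv
    refine conj_mem_majoranaSpan (fun i hi => ?_) hv
    have hk' := mem_majoranaSpan (γ := γ) (N := N) (i := k) (by omega)
    have hk1 := mem_majoranaSpan (γ := γ) hk
    by_cases h1 : i = k
    · subst h1
      rw [hγ.givens_conj_left hk]
      exact Submodule.add_mem _ (Submodule.smul_mem _ _ hk') (Submodule.smul_mem _ _ hk1)
    by_cases h2 : i = k + 1
    · subst h2
      rw [hγ.givens_conj_right hk]
      exact Submodule.add_mem _ (Submodule.smul_mem _ _ hk1) (Submodule.smul_mem _ _ hk')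
    rw [hγ.givens_conj_of_ne hk hi h1 h2 hcs]
    exact mem_majoranaSpan hi
  refine ⟨hγ.givens_mem_unitary hk hcs, key s hcs, fun v hv => ?_⟩
  have := key (-s) (by simpa using hcs) v hv
  rwa [hγ.star_givens hk, neg_neg, ← hγ.star_givens hk] at this

end IsMajorana

/-- Half angles: every point of the unit circle is the square of another one. -/
theorem exists_half_angle {r ρ : ℝ} (h : r ^ 2 + ρ ^ 2 = 1) :
    ∃ c s : ℝ, c ^ 2 + s ^ 2 = 1 ∧ c ^ 2 - s ^ 2 = r ∧ -(2 * c * s) = ρ := by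
  obtain ⟨z, hz⟩ := IsAlgClosed.exists_pow_nat_eq (⟨r, ρ⟩ : ℂ) (n := 2) (by norm_num)
  have hre := congrArg Complex.re hz
  have him := congrArg Complex.im hz
  simp only [pow_two, Complex.mul_re, Complex.mul_im] at hre him
  refine ⟨z.re, -z.im, ?_, by linarith, by linarith⟩
  have h2 : (z.re ^ 2 + (-z.im) ^ 2) ^ 2 = 1 := by
    rw [← h, ← hre, ← him]; ring
  nlinarith [sq_nonneg z.re, sq_nonneg z.im]

/-- A reflection of the last Majorana operator: a self-adjoint unitary whose conjugation negates
`γ (N - 1)` and fixes all the others. -/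
structure IsLastReflection (γ : ℕ → 𝔸) (N : ℕ) (X : 𝔸) : Prop where
  star_eq : star X = X
  sq : X * X = 1
  conj_of_lt : ∀ i, i + 1 < N → X * γ i * X = γ i
  conj_last : ∀ i, i + 1 = N → X * γ i * X = -γ i

theorem IsLastReflection.isGaussian {γ : ℕ → 𝔸} {N : ℕ} {X : 𝔸} (hX : IsLastReflection γ N X) :
    IsGaussian (majoranaSpan γ N) X := by
  have key : ∀ v ∈ majoranaSpan γ N, X * v * X ∈ majoranaSpan γ N := by
    intro v hv
    refine conj_mem_majoranaSpan (fun i hi => ?_) hv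
    rcases Nat.lt_or_ge (i + 1) N with h | h
    · rw [hX.conj_of_lt i h]; exact mem_majoranaSpan hi
    · rw [hX.conj_last i (by omega)]; exact Submodule.neg_mem _ (mem_majoranaSpan hi)
  exact ⟨by rw [Unitary.mem_iff, hX.star_eq]; exact ⟨hX.sq, hX.sq⟩,
    by rwa [hX.star_eq], by rwa [hX.star_eq]⟩

namespace IsMajorana

variable {γ : ℕ → 𝔸} {N : ℕ}

/-- Every unit vector `∑ r j • γ j` over `k ≤ j < N` is the image of `γ k` under a product of at most
`N - k` generators, all of which fix `γ j` for `j < k`. The plane rotations act on neighbouring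
Majorana operators only. -/
theorem exists_rotation (hγ : IsMajorana γ N) {X : 𝔸} (hX : IsLastReflection γ N X) {S : Set 𝔸}
    (hXS : X ∈ S)
    (hS : ∀ k, k + 1 < N → ∀ c s : ℝ, c ^ 2 + s ^ 2 = 1 → givens γ k c s ∈ S) (d : ℕ) :
    ∀ k, k + d + 1 = N → ∀ r : ℕ → ℝ, ∑ i ∈ Finset.Ico k N, r i ^ 2 = 1 →
      ∃ L : List 𝔸, (∀ g ∈ L, g ∈ S) ∧ L.length ≤ d + 1 ∧
        IsGaussian (majoranaSpan γ N) L.prod ∧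
        (∀ j < k, L.prod * γ j * star L.prod = γ j) ∧
        L.prod * γ k * star L.prod = ∑ i ∈ Finset.Ico k N, (r i : ℂ) • γ i := by
  induction d with
  | zero =>
    intro k hk r hr
    have hI : Finset.Ico k N = {k} := by ext; simp; omega
    rw [hI, Finset.sum_singleton] at hr ⊢
    rcases mul_self_eq_one_iff.1 ((pow_two _).symm.trans hr) with h | h
    · exact ⟨[], by simp, by simp, by simpa using IsGaussian.one _, by simp, by simp [h]⟩
    · refine ⟨[X], by simpa using hXS, by simp, by simpa using hX.isGaussian, ?_, ?_⟩
      · intro j hj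
        simpa [hX.star_eq] using hX.conj_of_lt j (by omega)
      · simpa [hX.star_eq, h] using hX.conj_last k (by omega)
  | succ d ih =>
    intro k hk r hr
    have hkN : k < N := by omega
    rw [Finset.sum_eq_sum_Ico_succ_bot hkN] at hr ⊢
    set ρ := Real.sqrt (∑ i ∈ Finset.Ico (k + 1) N, r i ^ 2)
    have hnn : 0 ≤ ∑ i ∈ Finset.Ico (k + 1) N, r i ^ 2 := Finset.sum_nonneg fun i _ => sq_nonneg _
    have hρ2 : ρ ^ 2 = ∑ i ∈ Finset.Ico (k + 1) N, r i ^ 2 := Real.sq_sqrt hnn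
    -- The component beyond `γ k` is `ρ` times a unit vector, an arbitrary one if `ρ = 0`.
    obtain ⟨r', hr', hrr'⟩ : ∃ r' : ℕ → ℝ, ∑ i ∈ Finset.Ico (k + 1) N, r' i ^ 2 = 1 ∧
        ∀ i ∈ Finset.Ico (k + 1) N, r i = ρ * r' i := by
      by_cases h0 : ρ = 0
      · refine ⟨fun i => if i = k + 1 then 1 else 0, ?_, fun i hi => ?_⟩
        · simp; omega
        · rw [h0] at hρ2
          have := (Finset.sum_eq_zero_iff_of_nonneg (fun i _ => sq_nonneg (r i))).1
            (by simpa using hρ2.symm) i hi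
          simpa [h0] using this
      · refine ⟨fun i => r i / ρ, ?_, fun i _ => by field_simp⟩
        simp_rw [div_pow]
        rw [← Finset.sum_div, ← hρ2, div_self (pow_ne_zero 2 h0)]
    obtain ⟨L, hLS, hLlen, hLG, hLfix, hLk⟩ := ih (k + 1) (by omega) r' hr'
    obtain ⟨c, s, hcs, hc, hs⟩ := exists_half_angle (r := r k) (ρ := ρ) (by rw [hρ2]; exact hr)
    have hk1 : k + 1 < N := by omega
    refine ⟨L ++ [givens γ k c s], ?_, by simpa using hLlen, ?_, ?_, ?_⟩
    · intro g hg
      rcases List.mem_append.1 hg with h | h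
      · exact hLS g h
      · rw [List.mem_singleton.1 h]; exact hS k hk1 c s hcs
    · simpa using hLG.mul (hγ.isGaussian_givens hk1 hcs)
    · intro j hj
      have h1 := hγ.givens_conj_of_ne hk1 (by omega : j < N) (by omega) (by omega) hcs
      have h2 := hLfix j (by omega)
      calc (L ++ [givens γ k c s]).prod * γ j * star (L ++ [givens γ k c s]).prod
          = L.prod * (givens γ k c s * γ j * star (givens γ k c s)) * star L.prod := by
            simp [mul_assoc]
        _ = γ j := by rw [h1, h2]
    · calc (L ++ [givens γ k c s]).prod * γ k * star (L ++ [givens γ k c s]).prod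
          = L.prod * (givens γ k c s * γ k * star (givens γ k c s)) * star L.prod := by
            simp [mul_assoc]
        _ = (r k : ℂ) • (L.prod * γ k * star L.prod)
            + (ρ : ℂ) • (L.prod * γ (k + 1) * star L.prod) := by
            rw [hγ.givens_conj_left hk1, hc, hs]; simp [mul_add, add_mul]
        _ = _ := by
            rw [hLfix k (by omega), hLk, Finset.smul_sum]
            congr 1
            refine Finset.sum_congr rfl fun i hi => ?_
            rw [hrr' i hi, smul_smul]; push_cast; rfl

/-- If the unitary `U` fixes `γ j` for all `j < k`, then the image of `γ k` has no component along
them, because conjugation preserves anticommutators. -/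
theorem exists_real_coeff_conj [Nontrivial 𝔸] (hγ : IsMajorana γ N) {U : 𝔸}
    (hU : IsGaussian (majoranaSpan γ N) U) {k : ℕ} (hk : k < N)
    (hfix : ∀ j < k, U * γ j * star U = γ j) :
    ∃ r : ℕ → ℝ, U * γ k * star U = ∑ i ∈ Finset.Ico k N, (r i : ℂ) • γ i ∧
      ∑ i ∈ Finset.Ico k N, r i ^ 2 = 1 := by
  have hUU := (Unitary.mem_iff.1 hU.mem).1
  have hUU' := (Unitary.mem_iff.1 hU.mem).2
  have hmul : ∀ x y : 𝔸, (U * x * star U) * (U * y * star U) = U * (x * y) * star U := by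
    intro x y
    calc (U * x * star U) * (U * y * star U) = U * x * (star U * U) * y * star U := by noncomm_ring
      _ = U * (x * y) * star U := by rw [hUU]; noncomm_ring
  obtain ⟨r, hr, hr1⟩ := hγ.exists_real_coeff (hU.conj _ (mem_majoranaSpan hk))
    (by simp [hγ.star_eq k hk, mul_assoc]) (by rw [hmul, hγ.sq k hk, mul_one, hUU'])
  have hzero : ∀ j < k, r j = 0 := by
    intro j hj
    have h1 := hγ.anticomm_sum (fun i => (r i : ℂ)) (hj.trans hk)
    rw [← hr, ← hfix j hj, hmul, hmul, hγ.anticomm k hk j (hj.trans hk) (by omega)] at h1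
    simp only [mul_neg, neg_mul, neg_add_cancel] at h1
    have h2 := smul_eq_zero.1 h1.symm
    simpa using h2
  have hsub : Finset.Ico k N ⊆ Finset.range N := fun i hi => by
    simp only [Finset.mem_Ico, Finset.mem_range] at *; omega
  have hz : ∀ i ∈ Finset.range N, i ∉ Finset.Ico k N → r i = 0 := fun i hi hi' => by
    simp only [Finset.mem_Ico, Finset.mem_range] at *; exact hzero i (by omega)
  refine ⟨r, ?_, ?_⟩
  · rw [hr]
    exact (Finset.sum_subset hsub fun i hi hi' => by rw [hz i hi hi']; simp).symm
  · rw [← hr1]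
    exact Finset.sum_subset hsub fun i hi hi' => by rw [hz i hi hi']; simp

/-- Every Gaussian unitary is, up to a scalar, a product of at most `N ^ 2` neighbouring Givens
rotations and reflections of the last Majorana operator, provided the Majorana operators act
irreducibly. -/
theorem exists_list_of_isGaussian [Nontrivial 𝔸] (hγ : IsMajorana γ N)
    (hirr : ∀ M : 𝔸, (∀ i < N, M * γ i = γ i * M) → ∃ z : ℂ, M = z • 1)
    {X : 𝔸} (hX : IsLastReflection γ N X) {S : Set 𝔸} (hXS : X ∈ S)
    (hS : ∀ k, k + 1 < N → ∀ c s : ℝ, c ^ 2 + s ^ 2 = 1 → givens γ k c s ∈ S)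
    {U : 𝔸} (hU : IsGaussian (majoranaSpan γ N) U) :
    ∃ (L : List 𝔸) (z : ℂ), (∀ g ∈ L, g ∈ S) ∧ L.length ≤ N * N ∧
      L.prod ∈ unitary 𝔸 ∧ U = z • L.prod := by
  suffices H : ∀ e k, k + e = N → ∀ U : 𝔸, IsGaussian (majoranaSpan γ N) U →
      (∀ j < k, U * γ j * star U = γ j) →
      ∃ (L : List 𝔸) (z : ℂ), (∀ g ∈ L, g ∈ S) ∧ L.length ≤ e * N ∧
      L.prod ∈ unitary 𝔸 ∧ U = z • L.prod from
    H N 0 (by omega) U hU (by simp)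
  intro e
  induction e with
  | zero =>
    intro k hk U hU hfix
    obtain ⟨z, hz⟩ := hirr U fun i hi => by
      conv_rhs => rw [← hfix i (by omega)]
      rw [mul_assoc, (Unitary.mem_iff.1 hU.mem).1, mul_one]
    exact ⟨[], z, by simp, by simp, one_mem _, by simpa using hz⟩
  | succ e ih =>
    intro k hk U hU hfix
    obtain ⟨r, hr, hr1⟩ := hγ.exists_real_coeff_conj hU (by omega : k < N) hfix
    obtain ⟨L, hLS, hLlen, hLG, hLfix, hLk⟩ := hγ.exists_rotation hX hXS hS e k (by omega) r hr1
    obtain ⟨hLL, hLL'⟩ := Unitary.mem_iff.1 hLG.mem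
    -- Moving `L.prod` to the other side of `L.prod * γ j * star L.prod = U * γ j * star U`.
    have hback : ∀ j, L.prod * γ j * star L.prod = U * γ j * star U →
        star L.prod * U * γ j * star (star L.prod * U) = γ j := by
      intro j hj
      calc star L.prod * U * γ j * star (star L.prod * U)
          = star L.prod * (U * γ j * star U) * L.prod := by simp [mul_assoc]
        _ = (star L.prod * L.prod) * γ j * (star L.prod * L.prod) := by rw [← hj]; noncomm_ring
        _ = γ j := by rw [hLL]; simp
    obtain ⟨L', z, hL'S, hL'len, hL'U, hL'⟩ := ih (k + 1) (by omega) (star L.prod * U)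
      (hLG.star.mul hU) fun j hj => hback j (by
        rcases Nat.lt_succ_iff_lt_or_eq.1 hj with h | h
        · rw [hLfix j h, hfix j h]
        · rw [h, hLk, hr])
    refine ⟨L ++ L', z, ?_, ?_, ?_, ?_⟩
    · intro g hg
      rcases List.mem_append.1 hg with h | h
      exacts [hLS g h, hL'S g h]
    · rw [List.length_append, Nat.succ_mul]; omega
    · rw [List.prod_append]; exact mul_mem hLG.mem hL'U
    · rw [List.prod_append, ← mul_smul_comm, ← hL', ← mul_assoc, hLL', one_mul]

end IsMajorana

end Clifford

/-! ### Exponentials of quadratic elements -/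

section Exponential

open NormedSpace

variable {𝔸 : Type*} [NormedRing 𝔸] [NormedAlgebra ℂ 𝔸]

/-- Left multiplication by `K` as a bounded operator. -/
noncomputable def mulLeftCLM (K : 𝔸) : 𝔸 →L[ℂ] 𝔸 := ContinuousLinearMap.mul ℂ 𝔸 K

/-- Right multiplication by `K` as a bounded operator. -/
noncomputable def mulRightCLM (K : 𝔸) : 𝔸 →L[ℂ] 𝔸 := (ContinuousLinearMap.mul ℂ 𝔸).flip K

theorem mulLeftCLM_apply (K x : 𝔸) : mulLeftCLM K x = K * x := rfl

theorem mulRightCLM_apply (K x : 𝔸) : mulRightCLM K x = x * K := rfl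

theorem mulLeftCLM_pow_apply (K : 𝔸) (n : ℕ) (x : 𝔸) : (mulLeftCLM K ^ n) x = K ^ n * x := by
  induction n generalizing x with
  | zero => simp
  | succ n ih => rw [pow_succ, mul_apply_eq_comp, ih, mulLeftCLM_apply, pow_succ, mul_assoc]

theorem mulRightCLM_pow_apply (K : 𝔸) (n : ℕ) (x : 𝔸) : (mulRightCLM K ^ n) x = x * K ^ n := by
  induction n generalizing x with
  | zero => simp
  | succ n ih => rw [pow_succ, mul_apply_eq_comp, ih, mulRightCLM_apply, pow_succ', mul_assoc]

variable [CompleteSpace 𝔸]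

theorem hasSum_exp_apply (D : 𝔸 →L[ℂ] 𝔸) (x : 𝔸) :
    HasSum (fun n : ℕ => ((n.factorial : ℂ)⁻¹) • (D ^ n) x) (exp D x) :=
  (exp_series_hasSum_exp' (𝕂 := ℂ) D).mapL (ContinuousLinearMap.apply ℂ 𝔸 x)

theorem exp_mulLeftCLM_apply (K x : 𝔸) : exp (mulLeftCLM K) x = exp K * x := by
  refine (hasSum_exp_apply (mulLeftCLM K) x).unique ?_
  simp only [mulLeftCLM_pow_apply, ← smul_mul_assoc]
  exact (exp_series_hasSum_exp' (𝕂 := ℂ) K).mul_right x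

theorem exp_mulRightCLM_apply (K x : 𝔸) : exp (mulRightCLM K) x = x * exp K := by
  refine (hasSum_exp_apply (mulRightCLM K) x).unique ?_
  simp only [mulRightCLM_pow_apply, ← mul_smul_comm]
  exact (exp_series_hasSum_exp' (𝕂 := ℂ) K).mul_left x

/-- If `ad K` preserves a closed subspace `V`, then so does conjugation by `exp K`, which is the
exponential of `ad K`. -/
theorem exp_conj_mem {V : Submodule ℂ 𝔸} (hV : IsClosed (V : Set 𝔸)) {K : 𝔸}
    (hK : ∀ v ∈ V, K * v - v * K ∈ V) {v : 𝔸} (hv : v ∈ V) : exp K * v * exp (-K) ∈ V := by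
  let _ := NormedAlgebra.restrictScalars ℚ ℂ (𝔸 →L[ℂ] 𝔸)
  have hcomm : Commute (mulLeftCLM K) (mulRightCLM (-K)) := by
    ext x
    simp [mulLeftCLM_apply, mulRightCLM_apply, mul_assoc]
  have hexp : exp (mulLeftCLM K + mulRightCLM (-K)) v = exp K * v * exp (-K) := by
    rw [exp_add_of_commute hcomm, mul_apply_eq_comp, exp_mulRightCLM_apply,
      exp_mulLeftCLM_apply, mul_assoc]
  rw [← hexp]
  have hpow : ∀ n : ℕ, ∀ v ∈ V, ((mulLeftCLM K + mulRightCLM (-K)) ^ n) v ∈ V := by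
    intro n
    induction n with
    | zero => intro v hv; simpa using hv
    | succ n ih =>
      intro v hv
      rw [pow_succ, mul_apply_eq_comp]
      refine ih _ ?_
      simpa [mulLeftCLM_apply, mulRightCLM_apply, sub_eq_add_neg] using hK v hv
  exact hV.mem_of_tendsto (hasSum_exp_apply _ v)
    (Filter.Eventually.of_forall fun s => Submodule.sum_mem _ fun n _ =>
      Submodule.smul_mem _ _ (hpow n v hv))

end Exponential

section Evolution

open scoped Matrix.Norms.Operator in
/-- The time evolution of a Hermitian `H` whose commutators preserve `V` is Gaussian. -/
theorem isGaussian_evolution {Q : Type} [Fintype Q] [DecidableEq Q] {H : QOp Q}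
    (hH : star H = H) {V : Submodule ℂ (QOp Q)} (hV : ∀ v ∈ V, H * v - v * H ∈ V) (t : ℝ) :
    IsGaussian V (evolution H t) := by
  have hstar : ∀ t : ℝ, star (evolution H t) = evolution H (-t) := by
    intro t
    rw [evolution, evolution, Matrix.star_eq_conjTranspose, ← Matrix.exp_conjTranspose,
      ← Matrix.star_eq_conjTranspose, star_smul, hH]
    congr 2
    simp
  have hneg : ∀ t : ℝ, evolution H (-t) = NormedSpace.exp (-((-(Complex.I * (t : ℂ))) • H)) := by
    intro t
    rw [evolution, ← neg_smul]
    congr 2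
    push_cast
    ring
  have hone : ∀ t : ℝ, evolution H t * evolution H (-t) = 1 := by
    intro t
    rw [hneg, evolution, ← Matrix.exp_add_of_commute _ _ ((Commute.refl ((-(Complex.I * (t : ℂ))) • H)).neg_right),
      add_neg_cancel, NormedSpace.exp_zero]
  have hconj : ∀ t : ℝ, ∀ v ∈ V, evolution H t * v * evolution H (-t) ∈ V := by
    intro t v hv
    rw [hneg, evolution]
    refine exp_conj_mem V.closed_of_finiteDimensional (fun v hv => ?_) hv
    rw [smul_mul_assoc, mul_smul_comm, ← smul_sub]
    exact V.smul_mem _ (hV v hv)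
  refine ⟨?_, ?_, ?_⟩
  · rw [Unitary.mem_iff, hstar]
    exact ⟨by simpa using hone (-t), hone t⟩
  · intro v hv
    rw [hstar]; exact hconj t v hv
  · intro v hv
    rw [hstar]; simpa using hconj (-t) v hv

end Evolution

/-! ### Majorana operators on the Fock space -/

section Fock

variable {m : ℕ}

/-- The occupation pattern `y` with the occupation of mode `j` flipped; `y` itself if `j ≥ m`. -/
def flipMode (j : ℕ) (y : Fin m → Bool) : Fin m → Bool := fun k => xor (y k) (decide (k.val = j))

/-- The Jordan-Wigner sign: the parity of the number of occupied modes below `i`. -/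
def jordanWignerSign (i : ℕ) (y : Fin m → Bool) : ℂ :=
  ∏ k : Fin m, if k.val < i ∧ y k = true then -1 else 1

theorem flipMode_flipMode (j : ℕ) (y : Fin m → Bool) : flipMode j (flipMode j y) = y := by
  ext k; simp [flipMode]

theorem flipMode_comm (i j : ℕ) (y : Fin m → Bool) :
    flipMode i (flipMode j y) = flipMode j (flipMode i y) := by
  ext k; simp only [flipMode]; rw [Bool.xor_assoc, Bool.xor_comm (decide _), Bool.xor_assoc]

theorem flipMode_eq_iff (j : ℕ) (x y : Fin m → Bool) : x = flipMode j y ↔ flipMode j x = y := by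
  constructor <;> (rintro rfl; simp [flipMode_flipMode])

theorem jordanWignerSign_sq (i : ℕ) (y : Fin m → Bool) :
    jordanWignerSign i y * jordanWignerSign i y = 1 := by
  rw [jordanWignerSign, ← Finset.prod_mul_distrib]
  exact Finset.prod_eq_one fun k _ => by split_ifs <;> norm_num

theorem jordanWignerSign_flipMode (i : ℕ) {j : ℕ} (hj : j < m) (y : Fin m → Bool) :
    jordanWignerSign i (flipMode j y) = (if j < i then -1 else 1) * jordanWignerSign i y := by
  have h : (if j < i then (-1 : ℂ) else 1)
      = ∏ k : Fin m, if k = ⟨j, hj⟩ then (if j < i then (-1 : ℂ) else 1) else 1 := by simp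
  rw [h, jordanWignerSign, jordanWignerSign, ← Finset.prod_mul_distrib]
  refine Finset.prod_congr rfl fun k _ => ?_
  by_cases hk : k = ⟨j, hj⟩
  · subst hk
    by_cases hji : j < i <;> cases hy : y ⟨j, hj⟩ <;> simp [flipMode, hji, hy]
  · have : k.val ≠ j := fun h => hk (Fin.ext h)
    simp [flipMode, hk, this]

theorem jordanWignerSign_succ {j : ℕ} (hj : j < m) (y : Fin m → Bool) :
    jordanWignerSign (j + 1) y
      = (if y ⟨j, hj⟩ = true then -1 else 1) * jordanWignerSign j y := by
  have h : (if y ⟨j, hj⟩ = true then (-1 : ℂ) else 1)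
      = ∏ k : Fin m, if k = ⟨j, hj⟩ then (if y ⟨j, hj⟩ = true then (-1 : ℂ) else 1) else 1 := by
    simp
  rw [h, jordanWignerSign, jordanWignerSign, ← Finset.prod_mul_distrib]
  refine Finset.prod_congr rfl fun k _ => ?_
  by_cases hk : k = ⟨j, hj⟩
  · subst hk; simp
  · have h1 : k.val ≠ j := fun h => hk (Fin.ext h)
    have h2 : k.val < j + 1 ↔ k.val < j := by omega
    simp [hk, h2]

theorem star_jordanWignerSign (i : ℕ) (y : Fin m → Bool) :
    star (jordanWignerSign i y) = jordanWignerSign i y := by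
  rw [jordanWignerSign, star_prod]
  exact Finset.prod_congr rfl fun k _ => by split_ifs <;> simp

/-- The operator `|y⟩ ↦ f y |y with mode j flipped⟩`. -/
def flipOp (j : ℕ) (f : (Fin m → Bool) → ℂ) : QOp (Fin m) :=
  Matrix.of fun x y => if x = flipMode j y then f y else 0

theorem mul_flipOp_apply (M : QOp (Fin m)) (j : ℕ) (f : (Fin m → Bool) → ℂ) (x y : Fin m → Bool) :
    (M * flipOp j f) x y = M x (flipMode j y) * f y := by
  simp [Matrix.mul_apply, flipOp]

theorem flipOp_mul_apply (M : QOp (Fin m)) (j : ℕ) (f : (Fin m → Bool) → ℂ) (x y : Fin m → Bool) :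
    (flipOp j f * M) x y = f (flipMode j x) * M (flipMode j x) y := by
  simp [Matrix.mul_apply, flipOp, flipMode_eq_iff]

theorem flipOp_mul_flipOp_apply (i j : ℕ) (f g : (Fin m → Bool) → ℂ) (x y : Fin m → Bool) :
    (flipOp i f * flipOp j g) x y
      = if x = flipMode i (flipMode j y) then f (flipMode j y) * g y else 0 := by
  rw [mul_flipOp_apply, flipOp, Matrix.of_apply, ite_mul, zero_mul]

/-- The amplitude of the `n`-th Majorana operator on `|y⟩`. -/
def majoranaCoeff (n : ℕ) (y : Fin m → Bool) : ℂ :=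
  Complex.I ^ (n % 2) * jordanWignerSign ((n + 1) / 2) y

/-- The Majorana operators in the order of the Jordan-Wigner chain: with `a_j` the annihilation
operator of mode `j`, `majorana m (2 * j) = a_j + a_j†` and
`majorana m (2 * j + 1) = -i (a_j - a_j†)`. Only the indices below `2 * m` are meaningful. -/
def majorana (m : ℕ) (n : ℕ) : QOp (Fin m) := flipOp (n / 2) (majoranaCoeff n)

theorem majoranaCoeff_flipMode (n : ℕ) {j : ℕ} (hj : j < m) (y : Fin m → Bool) :
    majoranaCoeff n (flipMode j y) = (if j < (n + 1) / 2 then -1 else 1) * majoranaCoeff n y := by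
  rw [majoranaCoeff, majoranaCoeff, jordanWignerSign_flipMode _ hj]; ring

theorem isMajorana_majorana (m : ℕ) : IsMajorana (majorana m) (2 * m) where
  star_eq n hn := by
    ext x y
    rw [Matrix.star_apply, majorana, flipOp, Matrix.of_apply, Matrix.of_apply]
    by_cases h : x = flipMode (n / 2) y
    · have h' : y = flipMode (n / 2) x := by rw [h, flipMode_flipMode]
      rw [if_pos h, if_pos h', h, majoranaCoeff_flipMode n (by omega), majoranaCoeff, star_mul,
        star_mul, star_jordanWignerSign]
      rcases Nat.mod_two_eq_zero_or_one n with h2 | h2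
      · have : ¬ n / 2 < (n + 1) / 2 := by omega
        simp [h2, this]
      · have : n / 2 < (n + 1) / 2 := by omega
        simp [h2, this, mul_comm]
    · have h' : ¬ y = flipMode (n / 2) x := fun h' => h (by rw [h', flipMode_flipMode])
      rw [if_neg h, if_neg h', star_zero]
  sq n hn := by
    ext x y
    rw [majorana, flipOp_mul_flipOp_apply, flipMode_flipMode, majoranaCoeff_flipMode n (by omega),
      Matrix.one_apply]
    congr 1
    have hs := jordanWignerSign_sq ((n + 1) / 2) y
    rw [majoranaCoeff]
    rcases Nat.mod_two_eq_zero_or_one n with h2 | h2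
    · have : ¬ n / 2 < (n + 1) / 2 := by omega
      simp [h2, this, hs]
    · have : n / 2 < (n + 1) / 2 := by omega
      simp only [h2, this, if_true, pow_one]
      linear_combination (-Complex.I ^ 2) * hs - Complex.I_sq
  anticomm n hn p hp hne := by
    ext x y
    rw [Matrix.neg_apply, majorana, majorana, flipOp_mul_flipOp_apply, flipOp_mul_flipOp_apply,
      majoranaCoeff_flipMode n (by omega), majoranaCoeff_flipMode p (by omega), flipMode_comm]
    rcases Nat.lt_or_gt_of_ne hne with h | h
    · have h1 : n / 2 < (p + 1) / 2 := by omega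
      have h2 : ¬ p / 2 < (n + 1) / 2 := by omega
      rw [if_pos h1, if_neg h2]
      split_ifs <;> ring
    · have h1 : ¬ n / 2 < (p + 1) / 2 := by omega
      have h2 : p / 2 < (n + 1) / 2 := by omega
      rw [if_neg h1, if_pos h2]
      split_ifs <;> ring

theorem majoranaCoeff_even (j : ℕ) (y : Fin m → Bool) :
    majoranaCoeff (2 * j) y = jordanWignerSign j y := by
  have h1 : (2 * j) % 2 = 0 := by omega
  have h2 : (2 * j + 1) / 2 = j := by omega
  rw [majoranaCoeff, h1, h2, pow_zero, one_mul]

theorem majoranaCoeff_odd {j : ℕ} (hj : j < m) (y : Fin m → Bool) :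
    majoranaCoeff (2 * j + 1) y
      = Complex.I * ((if y ⟨j, hj⟩ = true then -1 else 1) * jordanWignerSign j y) := by
  have h1 : (2 * j + 1) % 2 = 1 := by omega
  have h2 : (2 * j + 1 + 1) / 2 = j + 1 := by omega
  rw [majoranaCoeff, h1, h2, pow_one, jordanWignerSign_succ hj]

theorem majorana_even (m j : ℕ) :
    majorana m (2 * j) = flipOp j (jordanWignerSign j) := by
  have : (2 * j) / 2 = j := by omega
  rw [majorana, this]; congr 1; ext y; exact majoranaCoeff_even j y

theorem majorana_odd {m j : ℕ} (hj : j < m) :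
    majorana m (2 * j + 1) = flipOp j fun y =>
      Complex.I * ((if y ⟨j, hj⟩ = true then -1 else 1) * jordanWignerSign j y) := by
  have : (2 * j + 1) / 2 = j := by omega
  rw [majorana, this]; congr 1; ext y; exact majoranaCoeff_odd hj y

theorem flipMode_eq_update (j : Fin m) {y : Fin m → Bool} (hy : y j = true) :
    flipMode j y = Function.update y j false := by
  ext k
  by_cases hk : k = j
  · subst hk; simp [flipMode, hy]
  · have : k.val ≠ j.val := fun h => hk (Fin.ext h)
    simp [flipMode, hk, this]

theorem jordanWignerSign_eq_pow_card (j : Fin m) (y : Fin m → Bool) :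
    jordanWignerSign j y
      = (-1 : ℂ) ^ (Finset.univ.filter fun k : Fin m => k < j ∧ y k = true).card := by
  rw [jordanWignerSign, Finset.prod_ite, Finset.prod_const, Finset.prod_const_one, mul_one]
  rfl

theorem annihilation_eq (j : Fin m) :
    annihilation j
      = (1 / 2 : ℂ) • (majorana m (2 * j) + Complex.I • majorana m (2 * j + 1)) := by
  ext x y
  rw [majorana_even, majorana_odd j.2, Matrix.smul_apply, Matrix.add_apply, Matrix.smul_apply,
    flipOp, flipOp, Matrix.of_apply, Matrix.of_apply, annihilation, Matrix.of_apply,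
    ← jordanWignerSign_eq_pow_card]
  have hI : Complex.I * Complex.I = -1 := Complex.I_mul_I
  cases hy : y j with
  | true =>
    rw [flipMode_eq_update j hy]
    by_cases hx : x = Function.update y j false
    · simp only [hx, and_self, if_true, smul_eq_mul]
      linear_combination (1 / 2 * jordanWignerSign (↑j) y) * hI
    · simp [hx]
  | false =>
    by_cases hx : x = flipMode j y
    · simp only [hx, if_true, smul_eq_mul, Bool.false_eq_true, false_and, if_false]
      linear_combination (-1 / 2 * jordanWignerSign (↑j) y) * hI
    · simp [hx]

theorem annihilation_mem (j : Fin m) : annihilation j ∈ majoranaSpan (majorana m) (2 * m) := by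
  rw [annihilation_eq]
  exact Submodule.smul_mem _ _ (Submodule.add_mem _ (mem_majoranaSpan (by omega))
    (Submodule.smul_mem _ _ (mem_majoranaSpan (by omega))))

theorem creation_mem (j : Fin m) : creation j ∈ majoranaSpan (majorana m) (2 * m) := by
  have hγ := isMajorana_majorana m
  rw [creation, annihilation_eq, ← Matrix.star_eq_conjTranspose, star_smul, star_add, star_smul,
    hγ.star_eq _ (by omega), hγ.star_eq _ (by omega)]
  exact Submodule.smul_mem _ _ (Submodule.add_mem _ (mem_majoranaSpan (by omega))
    (Submodule.smul_mem _ _ (mem_majoranaSpan (by omega))))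

/-- A function of occupation patterns that is invariant under all flips is constant. -/
theorem eq_of_forall_flipMode {β : Type*} (f : (Fin m → Bool) → β)
    (hf : ∀ j < m, ∀ y, f (flipMode j y) = f y) (x y : Fin m → Bool) : f x = f y := by
  have H : ∀ s : Finset (Fin m), f (fun k => if k ∈ s then x k else y k) = f y := by
    intro s
    induction s using Finset.induction_on with
    | empty => simp
    | insert j s hj ih =>
      rw [← ih]
      by_cases hxy : x j = y j
      · congr 1; ext k
        by_cases hk : k = j
        · subst hk; simp [hxy, hj]
        · simp [hk]
      · rw [← hf j j.2]
        congr 1; ext k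
        by_cases hk : k = j
        · subst hk
          cases hx : x k <;> cases hy : y k <;> simp_all [flipMode]
        · have : k.val ≠ j.val := fun h => hk (Fin.ext h)
          simp [flipMode, hk, this]
  simpa using H Finset.univ

/-- The Majorana operators act irreducibly. Commuting with both operators of mode `j` forbids matrix
elements between states of different occupation of that mode and equates the diagonal entries
at `y` and at `y` with mode `j` flipped. -/
theorem eq_smul_one_of_commute_majorana (M : QOp (Fin m))
    (hM : ∀ n < 2 * m, M * majorana m n = majorana m n * M) : ∃ z : ℂ, M = z • 1 := by
  have hne : ∀ (i : ℕ) (y : Fin m → Bool), jordanWignerSign i y ≠ 0 := fun i y h => by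
    have := jordanWignerSign_sq i y
    simp [h] at this
  have hE : ∀ (j : Fin m) (x y : Fin m → Bool), M x (flipMode j y) * jordanWignerSign j y
      = jordanWignerSign j x * M (flipMode j x) y := by
    intro j x y
    have h := congrFun (congrFun (hM (2 * j) (by omega)) x) y
    rw [majorana_even, mul_flipOp_apply, flipOp_mul_apply, jordanWignerSign_flipMode _ j.2] at h
    simpa using h
  have hoff : ∀ (j : Fin m) (x y : Fin m → Bool), x j ≠ y j → M x y = 0 := by
    intro j x y hxy
    have h := congrFun (congrFun (hM (2 * j + 1) (by omega)) (flipMode j x)) y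
    rw [majorana_odd j.2, mul_flipOp_apply, flipOp_mul_apply, flipMode_flipMode] at h
    have h2 := hE j (flipMode j x) y
    rw [flipMode_flipMode, jordanWignerSign_flipMode _ j.2] at h2
    simp only [lt_irrefl, if_false, one_mul] at h2
    have h3 : (if x j = true then (-1 : ℂ) else 1) = - (if y j = true then (-1 : ℂ) else 1) := by
      cases hx : x j <;> cases hy : y j <;> simp_all
    have h4 : (if y j = true then (-1 : ℂ) else 1) ≠ 0 := by split_ifs <;> norm_num
    simp only [Fin.eta, h3] at h
    have h5 : (2 * Complex.I * (if y j = true then (-1 : ℂ) else 1) * jordanWignerSign j x)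
        * M x y = 0 := by
      linear_combination h - Complex.I * (if y j = true then (-1 : ℂ) else 1) * h2
    refine (mul_eq_zero.1 h5).resolve_left ?_
    exact mul_ne_zero (mul_ne_zero (mul_ne_zero two_ne_zero Complex.I_ne_zero) h4) (hne _ _)
  have hdiag : ∀ x y : Fin m → Bool, M x x = M y y := by
    refine eq_of_forall_flipMode (fun y => M y y) fun j hj y => ?_
    have h := hE ⟨j, hj⟩ (flipMode j y) y
    simp only [flipMode_flipMode, jordanWignerSign_flipMode _ hj, lt_irrefl, if_false,
      one_mul] at h
    exact mul_right_cancel₀ (hne j y) (h.trans (mul_comm _ _))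
  refine ⟨M (fun _ => false) (fun _ => false), ?_⟩
  ext x y
  rw [Matrix.smul_apply, Matrix.one_apply]
  by_cases hxy : x = y
  · subst hxy; simp [hdiag x (fun _ => false)]
  · obtain ⟨j, hj⟩ := Function.ne_iff.1 hxy
    simp [hxy, hoff j x y hj]

/-- Flipping the last qubit is a reflection of the last Majorana operator: it meets the
Jordan-Wigner sign of no other one. -/
theorem isLastReflection_flipOp (hm : 0 < m) :
    IsLastReflection (majorana m) (2 * m) (flipOp (m - 1) fun _ : Fin m → Bool => 1) := by
  have hconj : ∀ i : ℕ, (flipOp (m - 1) fun _ : Fin m → Bool => 1) * majorana m i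
      * (flipOp (m - 1) fun _ => 1)
      = flipOp (i / 2) fun y => (if m - 1 < (i + 1) / 2 then -1 else 1) * majoranaCoeff i y := by
    intro i
    ext x y
    rw [mul_flipOp_apply, majorana, flipOp_mul_flipOp_apply, flipMode_comm, flipMode_flipMode,
      majoranaCoeff_flipMode _ (by omega), one_mul, mul_one, flipOp, Matrix.of_apply]
  refine ⟨?_, ?_, fun i hi => ?_, fun i hi => ?_⟩
  · ext x y
    simp only [Matrix.star_apply, flipOp, Matrix.of_apply, flipMode_eq_iff (m - 1) y x,
      eq_comm (a := flipMode (m - 1) y)]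
    split_ifs <;> simp
  · ext x y
    rw [flipOp_mul_flipOp_apply, flipMode_flipMode, Matrix.one_apply, one_mul]
  · rw [hconj, if_neg (by omega)]
    simp [majorana]
  · rw [hconj, if_pos (by omega)]
    ext x y
    simp only [majorana, flipOp, Matrix.of_apply, Matrix.neg_apply]
    split_ifs <;> simp

end Fock

/-! ### Circuits -/

section Circuits

/-- The operator acting as `u` on the ordered pair of qubits `(a, b)` and trivially elsewhere. -/
def localOp {Q : Type} [Fintype Q] [DecidableEq Q] (a b : Q)
    (u : Matrix (Bool × Bool) (Bool × Bool) ℂ) : QOp Q :=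
  Matrix.of fun x y => if ∀ k, k ≠ a → k ≠ b → x k = y k then u (x a, x b) (y a, y b) else 0

section

set_option linter.unusedSectionVars false

variable {Q : Type} [Fintype Q] [DecidableEq Q]

theorem localOp_add (a b : Q) (u v : Matrix (Bool × Bool) (Bool × Bool) ℂ) :
    localOp a b (u + v) = localOp a b u + localOp a b v := by
  ext x y
  simp only [localOp, Matrix.of_apply, Matrix.add_apply]
  split_ifs <;> simp

theorem localOp_smul (a b : Q) (z : ℂ) (u : Matrix (Bool × Bool) (Bool × Bool) ℂ) :
    localOp a b (z • u) = z • localOp a b u := by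
  ext x y
  simp only [localOp, Matrix.of_apply, Matrix.smul_apply]
  split_ifs <;> simp

theorem localOp_one (a b : Q) : localOp a b 1 = 1 := by
  ext x y
  simp only [localOp, Matrix.of_apply, Matrix.one_apply, Prod.mk.injEq]
  by_cases hxy : x = y
  · simp [hxy]
  · rw [if_neg hxy, ite_eq_right_iff]
    intro h
    rw [if_neg]
    rintro ⟨ha, hb⟩
    refine hxy (funext fun k => ?_)
    by_cases hka : k = a
    · rw [hka, ha]
    by_cases hkb : k = b
    · rw [hkb, hb]
    exact h k hka hkb

theorem QCircuit.toOp_append (C D : QCircuit Q) :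
    QCircuit.toOp (C ++ D) = QCircuit.toOp D * QCircuit.toOp C := by
  induction C with
  | nil => simp [QCircuit.toOp]
  | cons g C ih => rw [List.cons_append, QCircuit.toOp, QCircuit.toOp, ih, mul_assoc]

variable {R : Type} [Fintype R] [DecidableEq R]

theorem onSystem_eq_kronecker (M : QOp Q) :
    onSystem R M = (Matrix.kroneckerMap (· * ·) M (1 : QOp R)).submatrix
      (Equiv.sumArrowEquivProdArrow Q R Bool) (Equiv.sumArrowEquivProdArrow Q R Bool) := by
  ext x y
  simp only [onSystem, Matrix.of_apply, Matrix.submatrix_apply, Matrix.kroneckerMap_apply,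
    Matrix.one_apply, Equiv.sumArrowEquivProdArrow, Equiv.coe_fn_mk, funext_iff, Function.comp_def]
  split_ifs <;> simp

theorem onSystem_one : onSystem R (1 : QOp Q) = 1 := by
  rw [onSystem_eq_kronecker, Matrix.one_kronecker_one, Matrix.submatrix_one_equiv]

theorem onSystem_mul (M N : QOp Q) : onSystem R (M * N) = onSystem R M * onSystem R N := by
  rw [onSystem_eq_kronecker, onSystem_eq_kronecker, onSystem_eq_kronecker,
    Matrix.submatrix_mul_equiv, ← Matrix.mul_kronecker_mul, mul_one]

theorem onSystem_add (M N : QOp Q) : onSystem R (M + N) = onSystem R M + onSystem R N := by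
  ext x y
  simp only [onSystem, Matrix.of_apply, Matrix.add_apply]
  split_ifs <;> simp

theorem onSystem_smul (z : ℂ) (M : QOp Q) : onSystem R (z • M) = z • onSystem R M := by
  ext x y
  simp only [onSystem, Matrix.of_apply, Matrix.smul_apply]
  split_ifs <;> simp

end

variable {m : ℕ}

/-- The operator `M` on the system is exactly a two-qubit gate of the register with two ancillas;
the second ancilla serves only for global phases. -/
def IsGate (M : QOp (Fin m)) : Prop :=
  ∃ g : TwoQubitGate (Fin m ⊕ Fin 2), g.toOp = onSystem (Fin 2) M

theorem isGate_of_eq_localOp {M : QOp (Fin m)} {a b : Fin m ⊕ Fin 2} (hab : a ≠ b)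
    {u : Matrix (Bool × Bool) (Bool × Bool) ℂ} (hu : u ∈ Matrix.unitaryGroup (Bool × Bool) ℂ)
    (h : onSystem (Fin 2) M = localOp a b u) : IsGate M :=
  ⟨⟨a, b, hab, ⟨u, hu⟩⟩, h.symm⟩

theorem exists_circuit_of_forall_isGate (L : List (QOp (Fin m))) (hL : ∀ M ∈ L, IsGate M) :
    ∃ C : QCircuit (Fin m ⊕ Fin 2), C.length = L.length ∧ C.toOp = onSystem (Fin 2) L.prod := by
  induction L with
  | nil => exact ⟨[], rfl, by rw [List.prod_nil, onSystem_one]; rfl⟩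
  | cons M L ih =>
    obtain ⟨C, hlen, hC⟩ := ih fun N hN => hL N (List.mem_cons_of_mem _ hN)
    obtain ⟨g, hg⟩ := hL M List.mem_cons_self
    refine ⟨C ++ [g], by simp [hlen], ?_⟩
    rw [QCircuit.toOp_append, hC, List.prod_cons, onSystem_mul, ← hg]
    simp [QCircuit.toOp]

theorem isGate_phase {z : ℂ} (hz : star z * z = 1) : IsGate (z • (1 : QOp (Fin m))) := by
  refine isGate_of_eq_localOp (a := Sum.inr 0) (b := Sum.inr 1) (u := z • 1) (by simp) ?_ ?_
  · rw [Matrix.mem_unitaryGroup_iff', star_smul, smul_mul_smul_comm, hz, star_one, one_mul,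
      one_smul]
  · rw [onSystem_smul, onSystem_one, localOp_smul, localOp_one]

/-- A self-adjoint involution generates the one-parameter group `c + i s F`. -/
theorem add_smul_mem_unitaryGroup {ι : Type*} [Fintype ι] [DecidableEq ι] {F : Matrix ι ι ℂ}
    (hF : star F = F) (hF2 : F * F = 1) {c s : ℝ} (hcs : c ^ 2 + s ^ 2 = 1) :
    (c : ℂ) • (1 : Matrix ι ι ℂ) + (s : ℂ) • Complex.I • F ∈ Matrix.unitaryGroup ι ℂ := by
  have hcs' : (c : ℂ) ^ 2 + (s : ℂ) ^ 2 = 1 := by exact_mod_cast hcs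
  rw [Matrix.mem_unitaryGroup_iff]
  simp only [star_add, star_smul, star_one, hF, add_mul, mul_add, smul_mul_smul_comm, one_mul,
    mul_one, hF2, RCLike.star_def, map_mul, Complex.conj_ofReal, Complex.conj_I, smul_smul]
  have : (1 : Matrix ι ι ℂ) = ((c : ℂ) ^ 2 + (s : ℂ) ^ 2) • 1 := by rw [hcs', one_smul]
  conv_rhs => rw [this]
  have hI : Complex.I ^ 2 = -1 := Complex.I_sq
  match_scalars
  · linear_combination (-(s : ℂ) ^ 2) * hI
  · ring

theorem isGate_givens_of_eq {k : ℕ} {a b : Fin m ⊕ Fin 2} (hab : a ≠ b)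
    {F : Matrix (Bool × Bool) (Bool × Bool) ℂ} (hF : star F = F) (hF2 : F * F = 1)
    (h : onSystem (Fin 2) (majorana m k * majorana m (k + 1)) = localOp a b (Complex.I • F))
    {c s : ℝ} (hcs : c ^ 2 + s ^ 2 = 1) : IsGate (givens (majorana m) k c s) := by
  refine isGate_of_eq_localOp hab (add_smul_mem_unitaryGroup hF hF2 hcs) ?_
  rw [givens, onSystem_add, onSystem_smul, onSystem_smul, onSystem_one, h, localOp_add,
    localOp_smul a b (c : ℂ), localOp_smul a b (s : ℂ), localOp_one]

/-- The Pauli `Z` on the first of two qubits. -/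
def pauliZFst : Matrix (Bool × Bool) (Bool × Bool) ℂ :=
  Matrix.diagonal fun a => if a.1 = true then -1 else 1

/-- The Pauli `X` on the first of two qubits. -/
def pauliXFst : Matrix (Bool × Bool) (Bool × Bool) ℂ :=
  Matrix.of fun a b => if a = (!b.1, b.2) then 1 else 0

/-- The Pauli `X ⊗ X` on two qubits. -/
def pauliXX : Matrix (Bool × Bool) (Bool × Bool) ℂ :=
  Matrix.of fun a b => if a = (!b.1, !b.2) then 1 else 0

theorem star_pauliZFst : star pauliZFst = pauliZFst := by
  ext ⟨a, b⟩ ⟨c, d⟩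
  cases a <;> cases b <;> cases c <;> cases d <;>
    simp [pauliZFst, Matrix.star_apply, Matrix.diagonal]

theorem pauliZFst_sq : pauliZFst * pauliZFst = 1 := by
  rw [pauliZFst, Matrix.diagonal_mul_diagonal, ← Matrix.diagonal_one]
  congr 1; ext a; split_ifs <;> norm_num

theorem star_pauliXFst : star pauliXFst = pauliXFst := by
  ext ⟨a, b⟩ ⟨c, d⟩
  cases a <;> cases b <;> cases c <;> cases d <;> simp [pauliXFst, Matrix.star_apply]

theorem pauliXFst_sq : pauliXFst * pauliXFst = 1 := by
  ext ⟨a, b⟩ ⟨c, d⟩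
  simp [pauliXFst, Matrix.mul_apply, Matrix.one_apply]

theorem star_pauliXX : star pauliXX = pauliXX := by
  ext ⟨a, b⟩ ⟨c, d⟩
  cases a <;> cases b <;> cases c <;> cases d <;> simp [pauliXX, Matrix.star_apply]

theorem pauliXX_sq : pauliXX * pauliXX = 1 := by
  ext ⟨a, b⟩ ⟨c, d⟩
  simp [pauliXX, Matrix.mul_apply, Matrix.one_apply]

/-- The two Majorana operators of mode `j` multiply to `i Z_j`. -/
theorem majorana_even_mul_apply {j : ℕ} (hj : j < m) (x y : Fin m → Bool) :
    (majorana m (2 * j) * majorana m (2 * j + 1)) x y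
      = if x = y then Complex.I * (if y ⟨j, hj⟩ = true then -1 else 1) else 0 := by
  rw [majorana_even, majorana_odd hj, flipOp_mul_flipOp_apply, flipMode_flipMode,
    jordanWignerSign_flipMode _ hj, if_neg (lt_irrefl j), one_mul]
  congr 1
  linear_combination (Complex.I * (if y ⟨j, hj⟩ = true then -1 else 1)) * jordanWignerSign_sq j y

/-- Majorana operators of neighbouring modes multiply to `i X_j X_{j+1}`: the Jordan-Wigner signs
cancel. -/
theorem majorana_odd_mul_apply {j : ℕ} (hj : j + 1 < m) (x y : Fin m → Bool) :
    (majorana m (2 * j + 1) * majorana m (2 * j + 1 + 1)) x y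
      = if x = flipMode j (flipMode (j + 1) y) then Complex.I else 0 := by
  have h1 : (2 * j + 1) / 2 = j := by omega
  have h2 : (2 * j + 1) % 2 = 1 := by omega
  have h3 : (2 * j + 1 + 1) / 2 = j + 1 := by omega
  rw [show 2 * j + 1 + 1 = 2 * (j + 1) by ring, majorana_even, majorana, flipOp_mul_flipOp_apply,
    majoranaCoeff, h1, h2, h3, jordanWignerSign_flipMode _ hj, if_neg (lt_irrefl _), one_mul,
    pow_one]
  congr 1
  linear_combination Complex.I * jordanWignerSign_sq (j + 1) y

theorem isGate_givens_even {j : ℕ} (hj : j < m) {c s : ℝ} (hcs : c ^ 2 + s ^ 2 = 1) :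
    IsGate (givens (majorana m) (2 * j) c s) := by
  refine isGate_givens_of_eq (a := Sum.inl ⟨j, hj⟩) (b := Sum.inr 0) (by simp) star_pauliZFst
    pauliZFst_sq ?_ hcs
  ext x y
  simp only [onSystem, localOp, Matrix.of_apply, majorana_even_mul_apply hj, Matrix.smul_apply,
    pauliZFst, Matrix.diagonal_apply, Prod.mk.injEq]
  by_cases hxy : x = y
  · simp [hxy]
  · have h1 : ¬ ((∀ r : Fin 2, x (Sum.inr r) = y (Sum.inr r)) ∧
        (fun k => x (Sum.inl k)) = fun k => y (Sum.inl k)) := by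
      rintro ⟨h, h'⟩
      exact hxy (funext fun k => by
        cases k with
        | inl k => exact congrFun h' k
        | inr r => exact h r)
    have h2 : ¬ ((∀ k, k ≠ Sum.inl ⟨j, hj⟩ → k ≠ Sum.inr 0 → x k = y k) ∧
        (x (Sum.inl ⟨j, hj⟩) = y (Sum.inl ⟨j, hj⟩) ∧ x (Sum.inr 0) = y (Sum.inr 0))) := by
      rintro ⟨h, ha, hb⟩
      refine hxy (funext fun k => ?_)
      by_cases hka : k = Sum.inl ⟨j, hj⟩
      · rw [hka, ha]
      by_cases hkb : k = Sum.inr 0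
      · rw [hkb, hb]
      exact h k hka hkb
    rw [← ite_and, if_neg h1, smul_ite, smul_zero, ← ite_and, if_neg h2]

theorem isGate_givens_odd {j : ℕ} (hj : j + 1 < m) {c s : ℝ} (hcs : c ^ 2 + s ^ 2 = 1) :
    IsGate (givens (majorana m) (2 * j + 1) c s) := by
  refine isGate_givens_of_eq (a := Sum.inl ⟨j, by omega⟩) (b := Sum.inl ⟨j + 1, hj⟩) (by simp)
    star_pauliXX pauliXX_sq ?_ hcs
  ext x y
  simp only [onSystem, localOp, Matrix.of_apply, majorana_odd_mul_apply hj, Matrix.smul_apply,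
    pauliXX, Prod.mk.injEq, smul_eq_mul, mul_ite, mul_one, mul_zero, ← ite_and]
  congr 1
  rw [eq_iff_iff]
  simp only [funext_iff, flipMode, Sum.forall, Sum.inl.injEq, ne_eq, reduceCtorEq,
    not_false_eq_true, forall_const, Fin.ext_iff]
  constructor
  · rintro ⟨h, h'⟩
    refine ⟨⟨fun k hk hk' => ?_, h⟩, ?_, ?_⟩
    · simpa [hk, hk'] using h' k
    · simpa using h' ⟨j, by omega⟩
    · simpa using h' ⟨j + 1, hj⟩
  · rintro ⟨⟨h, h'⟩, ha, hb⟩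
    refine ⟨h', fun k => ?_⟩
    by_cases hk : k.val = j
    · rw [show k = ⟨j, by omega⟩ from Fin.ext hk]
      simp [ha]
    by_cases hk' : k.val = j + 1
    · obtain rfl : k = ⟨j + 1, hj⟩ := Fin.ext hk'
      simp [hb]
    simpa [hk, hk'] using h k hk hk'

theorem isGate_givens {k : ℕ} (hk : k + 1 < 2 * m) {c s : ℝ} (hcs : c ^ 2 + s ^ 2 = 1) :
    IsGate (givens (majorana m) k c s) := by
  obtain ⟨j, rfl | rfl⟩ := Nat.even_or_odd' k
  · exact isGate_givens_even (by omega) hcs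
  · exact isGate_givens_odd (by omega) hcs

theorem isGate_flipOp {j : ℕ} (hj : j < m) : IsGate (flipOp j fun _ : Fin m → Bool => 1) := by
  refine isGate_of_eq_localOp (a := Sum.inl ⟨j, hj⟩) (b := Sum.inr 0) (u := pauliXFst) (by simp)
    ?_ ?_
  · rw [Matrix.mem_unitaryGroup_iff, star_pauliXFst, pauliXFst_sq]
  ext x y
  simp only [onSystem, localOp, Matrix.of_apply, flipOp, pauliXFst, Prod.mk.injEq, ← ite_and]
  congr 1
  rw [eq_iff_iff]
  simp only [funext_iff, flipMode, Sum.forall, Sum.inl.injEq, Sum.inr.injEq, ne_eq, reduceCtorEq,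
    not_false_eq_true, forall_const, Fin.ext_iff]
  constructor
  · rintro ⟨h, h'⟩
    refine ⟨⟨fun k hk => ?_, fun r _ => h r⟩, ?_, h 0⟩
    · simpa [hk] using h' k
    · simpa using h' ⟨j, hj⟩
  · rintro ⟨⟨h, h'⟩, ha, hb⟩
    refine ⟨fun r => ?_, fun k => ?_⟩
    · by_cases hr : r = 0
      · rw [hr, hb]
      · exact h' r (fun h => hr (Fin.ext h))
    · by_cases hk : k.val = j
      · obtain rfl : k = ⟨j, hj⟩ := Fin.ext hk
        simp [ha]
      · simpa [hk] using h k hk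

end Circuits

/-! ### Quadratic Hamiltonians -/

section Quadratic

variable {m : ℕ}

theorem star_quadraticHamiltonian {A : Matrix (Fin m) (Fin m) ℂ} (hA : A.IsHermitian)
    (B : Matrix (Fin m) (Fin m) ℂ) :
    star (quadraticHamiltonian A B) = quadraticHamiltonian A B := by
  have hc : ∀ i : Fin m, star (creation i) = annihilation i := fun i => by
    rw [creation, Matrix.star_eq_conjTranspose, Matrix.conjTranspose_conjTranspose]
  have ha : ∀ i : Fin m, star (annihilation i) = creation i := fun i => rfl
  have h1 : star (∑ i, ∑ j, A i j • (creation i * annihilation j))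
      = ∑ i, ∑ j, A i j • (creation i * annihilation j) := by
    conv_lhs => rw [Finset.sum_comm]
    simp only [star_sum, star_smul, star_mul, hc, ha]
    exact Finset.sum_congr rfl fun i _ => Finset.sum_congr rfl fun j _ => by rw [hA.apply]
  have h2 : star (∑ i, ∑ j, B i j • (annihilation i * annihilation j))
      = ∑ i, ∑ j, (starRingEnd ℂ) (B j i) • (creation i * creation j) := by
    rw [Finset.sum_comm]
    simp only [star_sum, star_smul, star_mul, ha]
    rfl
  rw [quadraticHamiltonian, star_add, star_add, h1, star_smul, star_smul, h2, ← h2, star_star]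
  simp only [RCLike.star_def, map_div₀, map_one, map_ofNat]
  exact add_right_comm _ _ _

theorem quadraticHamiltonian_commutator_mem (A B : Matrix (Fin m) (Fin m) ℂ) {v : QOp (Fin m)}
    (hv : v ∈ majoranaSpan (majorana m) (2 * m)) :
    quadraticHamiltonian A B * v - v * quadraticHamiltonian A B
      ∈ majoranaSpan (majorana m) (2 * m) := by
  set V := majoranaSpan (majorana m) (2 * m)
  -- The operators whose commutator with `v` lies in `V` form a linear subspace.
  let D : QOp (Fin m) →ₗ[ℂ] QOp (Fin m) := LinearMap.mulRight ℂ v - LinearMap.mulLeft ℂ v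
  change quadraticHamiltonian A B ∈ V.comap D
  have key : ∀ x ∈ V, ∀ y ∈ V, x * y ∈ V.comap D := fun x hx y hy =>
    (isMajorana_majorana m).commutator_mem hx hy hv
  have hsum : ∀ (c : Fin m → Fin m → ℂ) (f g : Fin m → QOp (Fin m)), (∀ i, f i ∈ V) →
      (∀ i, g i ∈ V) → ∑ i, ∑ j, c i j • (f i * g j) ∈ V.comap D := fun c f g hf hg =>
    Submodule.sum_mem _ fun i _ => Submodule.sum_mem _ fun j _ =>
      Submodule.smul_mem _ _ (key _ (hf i) _ (hg j))
  exact Submodule.add_mem _ (Submodule.add_mem _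
    (hsum A _ _ creation_mem annihilation_mem)
    (Submodule.smul_mem _ _ (hsum B _ _ annihilation_mem annihilation_mem)))
    (Submodule.smul_mem _ _
      (hsum (fun i j => (starRingEnd ℂ) (B j i)) _ _ creation_mem creation_mem))

/-- A Gaussian unitary on `m` modes is exactly a circuit of at most `1 + (2m)²` gates, one of them
for the global phase. -/
theorem exists_circuit_of_isGaussian {U : QOp (Fin m)}
    (hU : IsGaussian (majoranaSpan (majorana m) (2 * m)) U) :
    ∃ C : QCircuit (Fin m ⊕ Fin 2), C.length ≤ 1 + 2 * m * (2 * m) ∧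
      C.toOp = onSystem (Fin 2) U := by
  obtain ⟨L, z, hLg, hLlen, hLU, hUL⟩ : ∃ (L : List (QOp (Fin m))) (z : ℂ),
      (∀ g ∈ L, IsGate g) ∧ L.length ≤ 2 * m * (2 * m) ∧
      L.prod ∈ unitary (QOp (Fin m)) ∧ U = z • L.prod := by
    rcases Nat.eq_zero_or_pos m with hm | hm
    · obtain ⟨z, hz⟩ := eq_smul_one_of_commute_majorana U fun n hn => by omega
      exact ⟨[], z, by simp, by simp, one_mem _, by simpa using hz⟩
    · exact (isMajorana_majorana m).exists_list_of_isGaussian eq_smul_one_of_commute_majorana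
        (isLastReflection_flipOp hm) (S := {M | IsGate M}) (isGate_flipOp (by omega))
        (fun k hk c s hcs => isGate_givens hk hcs) hU
  have hz : star z * z = 1 := by
    have h := (Unitary.mem_iff.1 hU.mem).1
    rw [hUL, star_smul, smul_mul_smul_comm, (Unitary.mem_iff.1 hLU).1] at h
    exact smul_left_injective ℂ (one_ne_zero (α := QOp (Fin m))) (h.trans (one_smul ℂ _).symm)
  obtain ⟨C, hlen, hC⟩ := exists_circuit_of_forall_isGate ((z • 1) :: L) fun M hM => by
    rcases List.mem_cons.1 hM with rfl | h
    exacts [isGate_phase hz, hLg M h]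
  refine ⟨C, ?_, ?_⟩
  · rw [hlen, List.length_cons]; omega
  · rw [hC, List.prod_cons, hUL, smul_one_mul]

end Quadratic

theorem theorem5p2 (m : ℕ → ℕ) (hm : IsPolyBounded m)
    (A B : ∀ n : ℕ, Matrix (Fin (m n)) (Fin (m n)) ℂ) (hA : ∀ n, (A n).IsHermitian)
    (T : ℕ → ℝ) (hT : IsTwoPowOmega T) (α : ℕ → ℝ) (hα : IsInversePoly α) :
    CanBeFastForwarded m (fun n => quadraticHamiltonian (A n) (B n)) T α := by
  obtain ⟨p, hp⟩ := hm
  obtain ⟨q, hq⟩ := hα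
  refine ⟨2 + 2 * p * (2 * p), fun n hn t _ _ => ?_⟩
  obtain ⟨C, hlen, hC⟩ := exists_circuit_of_isGaussian
    (isGaussian_evolution (star_quadraticHamiltonian (hA n) (B n))
      (fun v hv => quadraticHamiltonian_commutator_mem (A n) (B n) hv) t)
  have heval : (2 + 2 * p * (2 * p)).eval n = 2 + 2 * p.eval n * (2 * p.eval n) := by simp
  refine ⟨2, C, by rw [heval]; omega, ?_, fun ψ _ => ?_⟩
  · rw [heval]
    have h2 : 2 * m n ≤ 2 * p.eval n := Nat.mul_le_mul_left 2 (hp n hn)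
    have := Nat.mul_le_mul h2 h2
    omega
  · have h0 : (0 : ℝ) ≤ α n := le_trans (by positivity) (hq n hn).2
    rw [hC, sub_self]
    simpa [QOp.app] using h0
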